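/- Let $k$ be a field, $R=k[x_1,\dots,x_d]$ with its standard grading, and let $J\subseteq R$ be a nonzero strongly stable monomial ideal, i.e. an ideal generated by monomials such that whenever $a<b$ and $\mu$ is a monomial with $\mu x_b\in J$, also $\mu x_a\in J$. For $1\le i\le d$ let the $i$-th partial degree of a monomial $x_1^{a_1}\cdots x_d^{a_d}$ be $a_1+\cdots+a_i$, and let $\omega_i(J)$ be the largest $i$-th partial degree of a minimal monomial generator of $J$. For a nonzero homogeneous ideal $I\subseteq R$ let $$\operatorname{reg}(I)=\max\{\,j-p \;:\; \operatorname{Tor}^R_p(I,k)_j\neq 0\,\}$$ be its Castelnuovo–Mumford regularity. Then for every $1\le i\le d$ both maxima $\omega_i(J)$ and $\operatorname{reg}(J+(x_{i+1},\dots,x_d))$ exist, and $$\operatorname{reg}\bigl(J+(x_{i+1},\dots,x_d)\bigr)=\omega_i(J).$$ -/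

import Mathlib

noncomputable section

namespace StableReg

open MvPolynomial

/-! ### The Koszul complex and graded `Tor` against the residue field

Throughout, `R = MvPolynomial (Fin d) k` is the polynomial ring `k[x_1, …, x_d]`; the variable
`x_{j+1}` is `X j` for `j : Fin d`. -/

/-- The sign `(-1)^{#{l ∈ G : l < j}}`, determined by `e_j ∧ e_G = sign • e_{G ∪ {j}}`. -/
def koszulSign {d : ℕ} (j : Fin d) (G : Finset (Fin d)) : ℤ :=
  (-1) ^ (G.filter (· < j)).card

/-- The differential of the Koszul complex `M ⊗_R K(x_1, …, x_d; R)`. An element of the total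
complex `⨁_p M ⊗ ⋀^p R^d` is written `∑_F f(F) ⊗ e_F`, that is, as a function `f` from subsets of
the index set to `M`; homological degree `p` consists of the functions supported on `p`-element
sets. The differential sends `m ⊗ e_F` to `∑_{j ∈ F} ± x_j m ⊗ e_{F \ {j}}`. -/
def koszulD (k : Type*) [Field k] (d : ℕ) (M : Type*) [AddCommGroup M]
    [Module (MvPolynomial (Fin d) k) M] :
    (Finset (Fin d) → M) →ₗ[MvPolynomial (Fin d) k] (Finset (Fin d) → M) where
  toFun f G := ∑ j ∈ Gᶜ, koszulSign j G • ((X j : MvPolynomial (Fin d) k) • f (insert j G))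
  map_add' f g := by
    funext G
    simp [smul_add, Finset.sum_add_distrib]
  map_smul' r f := by
    funext G
    simp only [Pi.smul_apply, RingHom.id_apply, Finset.smul_sum]
    refine Finset.sum_congr rfl fun j _ => ?_
    rw [smul_comm (X j : MvPolynomial (Fin d) k) r, smul_comm r (koszulSign j G)]

lemma koszulSign_mul_self {d : ℕ} (j : Fin d) (G : Finset (Fin d)) :
    koszulSign j G * koszulSign j G = 1 := by
  rw [koszulSign, ← pow_add, ← two_mul, pow_mul]
  simp

lemma koszulSign_swap {d : ℕ} {a b : Fin d} {G : Finset (Fin d)} (hab : a ≠ b) (ha : a ∉ G)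
    (hb : b ∉ G) :
    koszulSign a G * koszulSign b (insert a G) =
      -(koszulSign b G * koszulSign a (insert b G)) := by
  unfold koszulSign
  rw [Finset.filter_insert, Finset.filter_insert]
  rcases lt_or_gt_of_ne hab with h | h
  · rw [if_pos h, if_neg h.not_gt, Finset.card_insert_of_notMem (by simp [ha])]
    ring
  · rw [if_neg h.not_gt, if_pos h, Finset.card_insert_of_notMem (by simp [hb])]
    ring

lemma koszulD_comp_self (k : Type*) [Field k] (d : ℕ) (M : Type*) [AddCommGroup M]
    [Module (MvPolynomial (Fin d) k) M] (f : Finset (Fin d) → M) :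
    koszulD k d M (koszulD k d M f) = 0 := by
  funext G
  simp only [koszulD, LinearMap.coe_mk, AddHom.coe_mk, Finset.smul_sum, Pi.zero_apply]
  rw [Finset.sum_sigma']
  refine Finset.sum_involution (fun p _ => ⟨p.2, p.1⟩) ?_ ?_ ?_ ?_
  · rintro ⟨a, b⟩ h
    simp only [Finset.mem_sigma, Finset.mem_compl, Finset.mem_insert, not_or] at h
    obtain ⟨ha, hba, hb⟩ := h
    have key := koszulSign_swap (Ne.symm hba) ha hb
    simp only
    rw [smul_comm (X a : MvPolynomial (Fin d) k) (koszulSign b (insert a G)),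
      smul_comm (X b : MvPolynomial (Fin d) k) (koszulSign a (insert b G)),
      smul_smul, smul_smul (koszulSign b G), key, Finset.insert_comm a b,
      smul_comm (X a : MvPolynomial (Fin d) k) (X b : MvPolynomial (Fin d) k), neg_smul,
      neg_add_cancel]
  · rintro ⟨a, b⟩ h _ heq
    simp only [Finset.mem_sigma, Finset.mem_compl, Finset.mem_insert, not_or] at h
    simp only [Sigma.mk.injEq] at heq
    exact h.2.1 heq.1
  · rintro ⟨a, b⟩ h
    simp only [Finset.mem_sigma, Finset.mem_compl, Finset.mem_insert, not_or] at h ⊢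
    exact ⟨h.2.2, fun e => h.2.1 e.symm, h.1⟩
  · rintro ⟨a, b⟩ _
    rfl

/-- Contracting operator in the direction of `x_m`. -/
def koszulH {k : Type*} [Field k] {d : ℕ} (m : Fin d)
    (f : Finset (Fin d) → MvPolynomial (Fin d) k) : Finset (Fin d) → MvPolynomial (Fin d) k :=
  fun G => if m ∈ G then koszulSign m (G.erase m) •
    ((f (G.erase m)).divMonomial (Finsupp.single m 1)) else 0

/-- Division by `x_m` (discarding the terms not divisible by `x_m`). -/
def divX {k : Type*} [Field k] {d : ℕ} (m : Fin d) :
    MvPolynomial (Fin d) k →+ MvPolynomial (Fin d) k where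
  toFun q := q.divMonomial (Finsupp.single m 1)
  map_zero' := zero_divMonomial _
  map_add' p q := add_divMonomial p q _

lemma divX_apply {k : Type*} [Field k] {d : ℕ} (m : Fin d) (q : MvPolynomial (Fin d) k) :
    divX m q = q.divMonomial (Finsupp.single m 1) := rfl

lemma divMonomial_X_mul {k : Type*} [Field k] {d : ℕ} {m j : Fin d} (h : j ≠ m)
    (q : MvPolynomial (Fin d) k) :
    (X j * q).divMonomial (Finsupp.single m 1) = X j * q.divMonomial (Finsupp.single m 1) := by
  classical
  ext c
  rw [coeff_divMonomial, coeff_X_mul', coeff_X_mul']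
  have hs : j ∈ (Finsupp.single m 1 + c).support ↔ j ∈ c.support := by
    simp [h.symm]
  simp only [hs]
  split_ifs with hc
  · rw [coeff_divMonomial]
    congr 1
    ext l
    by_cases hl : l = j
    · subst hl
      simp [h.symm]
    · simp [Finsupp.single_apply, Ne.symm hl]
  · rfl

lemma koszul_homotopy {k : Type*} [Field k] {d : ℕ} (m : Fin d)
    (f : Finset (Fin d) → MvPolynomial (Fin d) k) (F : Finset (Fin d)) :
    koszulD k d _ (koszulH m f) F + koszulH m (koszulD k d _ f) F =
      f F - if m ∈ F then 0 else (f F).modMonomial (Finsupp.single m 1) := by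
  classical
  by_cases hm : m ∈ F
  · rw [if_pos hm, sub_zero]
    obtain ⟨G, hG, rfl⟩ : ∃ G, m ∉ G ∧ F = insert m G :=
      ⟨F.erase m, Finset.notMem_erase _ _, (Finset.insert_erase hm).symm⟩
    have hc : Gᶜ = insert m (insert m G)ᶜ := by
      ext l
      by_cases hl : l = m <;> simp [hl, hG]
    have e1 : koszulH m (koszulD k d _ f) (insert m G) = f (insert m G) +
        ∑ j ∈ (insert m G)ᶜ, (koszulSign m G * koszulSign j G) •
          (X j * (f (insert j G)).divMonomial (Finsupp.single m 1)) := by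
      simp only [koszulH, koszulD, LinearMap.coe_mk, AddHom.coe_mk, Finset.mem_insert_self, if_true,
        Finset.erase_insert hG]
      rw [hc, Finset.sum_insert (by simp), add_divMonomial, smul_add]
      congr 1
      · rw [← divX_apply m, map_zsmul, smul_smul, koszulSign_mul_self, one_smul]
        rw [divX_apply, smul_eq_mul, X_mul_divMonomial]
      · rw [← divX_apply m, map_sum, Finset.smul_sum]
        refine Finset.sum_congr rfl fun j hj => ?_
        simp only [Finset.mem_compl, Finset.mem_insert, not_or] at hj
        rw [map_zsmul, smul_smul, divX_apply m, smul_eq_mul, divMonomial_X_mul hj.1]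
    have e2 : koszulD k d _ (koszulH m f) (insert m G) =
        -∑ j ∈ (insert m G)ᶜ, (koszulSign m G * koszulSign j G) •
          (X j * (f (insert j G)).divMonomial (Finsupp.single m 1)) := by
      simp only [koszulH, koszulD, LinearMap.coe_mk, AddHom.coe_mk]
      rw [← Finset.sum_neg_distrib]
      refine Finset.sum_congr rfl fun j hj => ?_
      simp only [Finset.mem_compl, Finset.mem_insert, not_or] at hj
      have he : (insert j (insert m G)).erase m = insert j G := by
        rw [Finset.insert_comm, Finset.erase_insert]
        simp [hG, Ne.symm hj.1]
      rw [if_pos (by simp), he, smul_eq_mul, mul_smul_comm, smul_smul, ← neg_smul]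
      congr 1
      have h1 := koszulSign_swap hj.1 hj.2 hG
      have h2 := koszulSign_mul_self m G
      have h3 := koszulSign_mul_self j G
      calc koszulSign j (insert m G) * koszulSign m (insert j G)
          = (koszulSign j G * koszulSign j G) *
              (koszulSign j (insert m G) * koszulSign m (insert j G)) := by rw [h3, one_mul]
        _ = (koszulSign j G * koszulSign m (insert j G)) *
              (koszulSign j G * koszulSign j (insert m G)) := by ring
        _ = -(koszulSign m G * koszulSign j G) *
              (koszulSign j (insert m G) * koszulSign j (insert m G)) := by rw [h1]; ring
        _ = _ := by rw [koszulSign_mul_self, mul_one]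
    rw [e1, e2]
    abel
  · rw [if_neg hm]
    have e1 : koszulH m (koszulD k d _ f) F = 0 := by simp [koszulH, hm]
    rw [e1, add_zero]
    simp only [koszulH, koszulD, LinearMap.coe_mk, AddHom.coe_mk]
    rw [Finset.sum_eq_single m]
    · rw [if_pos (Finset.mem_insert_self _ _), Finset.erase_insert hm, smul_eq_mul, mul_smul_comm,
        smul_smul, koszulSign_mul_self, one_smul, eq_sub_iff_add_eq]
      exact divMonomial_add_modMonomial_single (f F) m
    · intro j _ hj
      rw [if_neg (by simp [hm, Ne.symm hj]), smul_zero, smul_zero]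
    · intro h
      simp [hm] at h

/-- The Koszul complex of `R` is exact in positive homological degree. -/
theorem koszul_exact (k : Type*) [Field k] (d p : ℕ) (hp : 1 ≤ p)
    (f : Finset (Fin d) → MvPolynomial (Fin d) k) (hf : ∀ F, F.card ≠ p → f F = 0)
    (hD : koszulD k d _ f = 0) :
    ∃ g : Finset (Fin d) → MvPolynomial (Fin d) k,
      (∀ F, F.card ≠ p + 1 → g F = 0) ∧ koszulD k d _ g = f := by
  classical
  have step : ∀ S : Finset (Fin d), ∃ g : Finset (Fin d) → MvPolynomial (Fin d) k,
      ∀ F : Finset (Fin d), (∃ s ∈ S, s ∈ F) →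
      (f - koszulD k d _ g) F = 0 := by
    intro S
    induction S using Finset.induction_on with
    | empty => exact ⟨0, by simp⟩
    | insert m S _ ih =>
      obtain ⟨g, hg⟩ := ih
      refine ⟨g + koszulH m (f - koszulD k d _ g), ?_⟩
      rintro F ⟨s, hs, hsF⟩
      have hcyc : koszulD k d _ (f - koszulD k d _ g) = 0 := by
        rw [map_sub, hD, koszulD_comp_self, sub_zero]
      have h := koszul_homotopy m (f - koszulD k d _ g) F
      have hz : koszulH m (koszulD k d _ (f - koszulD k d _ g)) F = 0 := by
        rw [hcyc]
        simp [koszulH]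
      rw [hz, add_zero] at h
      rw [map_add, ← sub_sub, Pi.sub_apply, h, sub_sub_cancel]
      split_ifs with hm
      · rfl
      · rw [hg F ⟨s, ?_, hsF⟩]
        · exact monomial_one_dvd_iff_modMonomial_eq_zero.1 (dvd_zero _)
        · rcases Finset.mem_insert.1 hs with rfl | h'
          · exact absurd hsF hm
          · exact h'
  obtain ⟨g, hg⟩ := step Finset.univ
  refine ⟨fun F => if F.card = p + 1 then g F else 0, fun F hF => if_neg hF, ?_⟩
  funext F
  have hins : ∀ j ∈ Fᶜ, (insert j F).card = F.card + 1 := fun j hj =>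
    Finset.card_insert_of_notMem (by simpa using hj)
  by_cases hF : F.card = p
  · have hne : F.Nonempty := Finset.card_pos.1 (by omega)
    obtain ⟨s, hs⟩ := hne
    have h := hg F ⟨s, Finset.mem_univ _, hs⟩
    rw [Pi.sub_apply, sub_eq_zero] at h
    rw [h]
    simp only [koszulD, LinearMap.coe_mk, AddHom.coe_mk]
    refine Finset.sum_congr rfl fun j hj => ?_
    rw [if_pos (by rw [hins j hj, hF])]
  · rw [hf F hF]
    simp only [koszulD, LinearMap.coe_mk, AddHom.coe_mk]
    refine Finset.sum_eq_zero fun j hj => ?_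
    rw [if_neg (by rw [hins j hj]; omega), smul_zero, smul_zero]

/-- The cokernel of the last Koszul map is `R / (x_1, …, x_d) = k`. With `koszul_exact`, the
Koszul complex is a (graded) free resolution of `k` over `R`. -/
theorem koszul_coker (k : Type*) [Field k] (d : ℕ) (r : MvPolynomial (Fin d) k) :
    (∃ g : Finset (Fin d) → MvPolynomial (Fin d) k, koszulD k d _ g ∅ = r) ↔
      r ∈ Ideal.span (Set.range (X : Fin d → MvPolynomial (Fin d) k)) := by
  have hs : ∀ j : Fin d, koszulSign j ∅ = 1 := fun j => by simp [koszulSign]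
  rw [Ideal.mem_span_range_iff_exists_fun]
  constructor
  · rintro ⟨g, rfl⟩
    exact ⟨fun j => g {j}, by simp [koszulD, hs, mul_comm]⟩
  · rintro ⟨c, rfl⟩
    refine ⟨fun F => ∑ j ∈ F, c j, by simp [koszulD, hs, mul_comm]⟩

section Tor

variable {k : Type*} [Field k] {d : ℕ} {M : Type*} [AddCommGroup M] [Module k M]
  [Module (MvPolynomial (Fin d) k) M] [IsScalarTower k (MvPolynomial (Fin d) k) M]

/-- The part of homological degree `p` and internal degree `j` of `M ⊗_R K(x_1, …, x_d; R)`, for a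
`ℤ`-graded module `M = ⨁ 𝓜 j`; the basis element `e_F` has internal degree `|F|`. -/
def koszulPiece (𝓜 : ℤ → Submodule k M) (p : ℕ) (j : ℤ) :
    Submodule k (Finset (Fin d) → M) :=
  Submodule.pi Set.univ fun F => if F.card = p then 𝓜 (j - p) else ⊥

/-- Koszul cycles of homological degree `p` and internal degree `j`. -/
def koszulCycles (𝓜 : ℤ → Submodule k M) (p : ℕ) (j : ℤ) :
    Submodule k (Finset (Fin d) → M) :=
  koszulPiece 𝓜 p j ⊓ LinearMap.ker ((koszulD k d M).restrictScalars k)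

/-- Koszul boundaries of homological degree `p` and internal degree `j`. -/
def koszulBoundaries (𝓜 : ℤ → Submodule k M) (p : ℕ) (j : ℤ) :
    Submodule k (Finset (Fin d) → M) :=
  (koszulPiece 𝓜 (p + 1) j).map ((koszulD k d M).restrictScalars k)

/-- The graded piece `Tor_p^R(M, k)_j`: homology of `M ⊗_R K`, where `K` is the graded free
(Koszul) resolution of `k` over `R`. -/
abbrev GradedTor (𝓜 : ℤ → Submodule k M) (p : ℕ) (j : ℤ) : Type _ :=
  koszulCycles (d := d) 𝓜 p j ⧸
    (koszulBoundaries (d := d) 𝓜 p j).submoduleOf (koszulCycles (d := d) 𝓜 p j)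

variable (d) in
/-- The set `{j - p | Tor_p^R(M, k)_j ≠ 0}`. -/
def torShifts (𝓜 : ℤ → Submodule k M) : Set ℤ :=
  {r | ∃ (p : ℕ) (j : ℤ), Nontrivial (GradedTor (d := d) 𝓜 p j) ∧ r = j - p}

end Tor

/-- The degree `j` part `I ∩ R_j` of an ideal `I`, for the standard grading of `R`. -/
def idealGrading {k : Type*} [Field k] {d : ℕ} (I : Ideal (MvPolynomial (Fin d) k)) (j : ℤ) :
    Submodule k I :=
  (weightedHomogeneousSubmodule k (fun _ : Fin d => (1 : ℤ)) j).comap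
    (I.subtype.restrictScalars k)

/-- The Castelnuovo–Mumford regularity `max {j - p | Tor_p^R(I, k)_j ≠ 0}` of a homogeneous ideal,
as a supremum (meaningful when the maximum exists). -/
def reg {k : Type*} [Field k] {d : ℕ} (I : Ideal (MvPolynomial (Fin d) k)) : ℤ :=
  sSup (torShifts d (idealGrading I))

/-! ### Monomial ideals -/

/-- An ideal generated by monomials. -/
def IsMonomialIdeal {k : Type*} [Field k] {d : ℕ} (J : Ideal (MvPolynomial (Fin d) k)) : Prop :=
  ∃ S : Set (Fin d →₀ ℕ), J = Ideal.span ((fun s => monomial s (1 : k)) '' S)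

/-- A monomial ideal `J` such that `μ x_b ∈ J` implies `μ x_a ∈ J`, for monomials `μ` and
`a < b`. -/
def IsStronglyStable {k : Type*} [Field k] {d : ℕ} (J : Ideal (MvPolynomial (Fin d) k)) : Prop :=
  IsMonomialIdeal J ∧ ∀ (a b : Fin d) (μ : Fin d →₀ ℕ), a < b →
    monomial μ (1 : k) * X b ∈ J → monomial μ (1 : k) * X a ∈ J

/-- The `i`-th partial degree of `x^μ`: the sum of the exponents of `x_1, …, x_i`. -/
def partialDegree {d : ℕ} (i : ℕ) (μ : Fin d →₀ ℕ) : ℕ :=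
  ∑ j : Fin d with j.val < i, μ j

/-- `x^μ` is a minimal monomial generator of the monomial ideal `J`: it is minimal with respect to
divisibility among the monomials in `J`. -/
def IsMinimalGenerator {k : Type*} [Field k] {d : ℕ} (J : Ideal (MvPolynomial (Fin d) k))
    (μ : Fin d →₀ ℕ) : Prop :=
  Minimal (fun ν : Fin d →₀ ℕ => monomial ν (1 : k) ∈ J) μ

/-- The `i`-th partial degrees of the minimal monomial generators of `J`. -/
def generatorPartialDegrees {k : Type*} [Field k] {d : ℕ} (i : ℕ)
    (J : Ideal (MvPolynomial (Fin d) k)) : Set ℕ :=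
  partialDegree i '' {μ | IsMinimalGenerator J μ}

/-- `ω_i(J)`, the largest `i`-th partial degree of a minimal monomial generator of `J`. -/
def omega {k : Type*} [Field k] {d : ℕ} (i : ℕ) (J : Ideal (MvPolynomial (Fin d) k)) : ℕ :=
  sSup (generatorPartialDegrees i J)

/-- The ideal `(x_{i+1}, …, x_d)`. -/
def lastVars (k : Type*) [Field k] (d i : ℕ) : Ideal (MvPolynomial (Fin d) k) :=
  Ideal.span (X '' {j : Fin d | i ≤ j.val})

end StableReg

end

noncomputable section

namespace StableReg

open MvPolynomial

/-! ### Monomials in monomial ideals -/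

section Monomials

variable {k : Type*} [Field k] {d : ℕ} {J : Ideal (MvPolynomial (Fin d) k)}

/-! Put `I = J + (x_{i+1}, …, x_d)`. Both inequalities come from exchanging variables in `J`.

Lower bound: if a minimal generator of largest `i`-th partial degree contained a late variable,
trading it for `x_i` would produce a generator dividing too little of the new monomial, and a
further exchange would contradict minimality. So it lies in `k[x_1, …, x_i]`, has degree `ω_i(J)`,
remains a minimal generator of `I`, and gives a class in `Tor_0`
(`IsMinimalGenerator.degree_mem_torShifts`).

Upper bound: `Tor` is Koszul homology, which splits by multidegree. In multidegree `α` let `x_m` be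
the last of the first `i` variables occurring in `α`. Above degree `ω_i(J)`, dividing by `x_m` does
not leave `I` (`IsStronglyStable.exists_cone_vertex`), so the homotopy that contracts the Koszul
complex of `R` in direction `x_m` carries cycles over `I` to chains over `I`. Every cycle with `j -
p > ω_i(J)` is thus a boundary (`IsMonomialIdeal.koszulCycles_le_koszulBoundaries`). -/

lemma monomial_mem_of_le {μ ν : Fin d →₀ ℕ} (h : μ ≤ ν) (hμ : monomial μ (1 : k) ∈ J) :
    monomial ν (1 : k) ∈ J := by
  have e : monomial ν (1 : k) = monomial (ν - μ) 1 * monomial μ 1 := by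
    rw [monomial_mul, tsub_add_cancel_of_le h, one_mul]
  rw [e]
  exact J.mul_mem_left _ hμ

lemma IsMonomialIdeal.mem_iff (hJ : IsMonomialIdeal J) (q : MvPolynomial (Fin d) k) :
    q ∈ J ↔ ∀ β, coeff β q ≠ 0 → monomial β (1 : k) ∈ J := by
  classical
  obtain ⟨S, rfl⟩ := hJ
  rw [mem_ideal_span_monomial_image]
  simp only [mem_ideal_span_monomial_image, mem_support_iff, coeff_monomial]
  simp

lemma exists_isMinimalGenerator_le {μ : Fin d →₀ ℕ} (hμ : monomial μ (1 : k) ∈ J) :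
    ∃ ν ≤ μ, IsMinimalGenerator J ν :=
  exists_minimal_le_of_wellFoundedLT (fun ν : Fin d →₀ ℕ => monomial ν (1 : k) ∈ J) μ hμ

lemma IsMinimalGenerator.eq_of_le {μ ν : Fin d →₀ ℕ} (hμ : IsMinimalGenerator J μ)
    (hν : monomial ν (1 : k) ∈ J) (h : ν ≤ μ) : ν = μ :=
  le_antisymm h (hμ.2 hν h)

/-- Dickson's lemma: minimal elements form an antichain, and `ℕ^d` is well-quasi-ordered. -/
lemma finite_isMinimalGenerator (J : Ideal (MvPolynomial (Fin d) k)) :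
    {μ | IsMinimalGenerator J μ}.Finite :=
  WellQuasiOrderedLE.finite_of_isAntichain (setOfPred_minimal_antichain _)

lemma exists_isMinimalGenerator (hJ : IsMonomialIdeal J) (hJ0 : J ≠ ⊥) :
    ∃ μ, IsMinimalGenerator J μ := by
  obtain ⟨q, hq, hq0⟩ := J.ne_bot_iff.1 hJ0
  obtain ⟨β, hβ⟩ := ne_zero_iff.1 hq0
  obtain ⟨ν, -, hν⟩ := exists_isMinimalGenerator_le ((hJ.mem_iff q).1 hq β hβ)
  exact ⟨ν, hν⟩

lemma isGreatest_omega (hJ : IsMonomialIdeal J) (hJ0 : J ≠ ⊥) (i : ℕ) :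
    IsGreatest (generatorPartialDegrees i J) (omega i J) := by
  have hf : (generatorPartialDegrees i J).Finite := (finite_isMinimalGenerator J).image _
  have hne : (generatorPartialDegrees i J).Nonempty := by
    obtain ⟨μ, hμ⟩ := exists_isMinimalGenerator hJ hJ0
    exact ⟨_, μ, hμ, rfl⟩
  exact ⟨Nat.sSup_mem hne hf.bddAbove, fun _ h => le_csSup hf.bddAbove h⟩

lemma IsMonomialIdeal.sup_lastVars (hJ : IsMonomialIdeal J) (i : ℕ) :
    IsMonomialIdeal (J ⊔ lastVars k d i) := by
  obtain ⟨S, rfl⟩ := hJ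
  refine ⟨S ∪ (fun j => Finsupp.single j 1) '' {j : Fin d | i ≤ j.val}, ?_⟩
  rw [Set.image_union, Ideal.span_union, Set.image_image]
  rfl

lemma IsMonomialIdeal.monomial_mem_sup_lastVars (hJ : IsMonomialIdeal J) {i : ℕ}
    {β : Fin d →₀ ℕ} :
    monomial β (1 : k) ∈ J ⊔ lastVars k d i ↔
      monomial β (1 : k) ∈ J ∨ ∃ j : Fin d, i ≤ j.val ∧ β j ≠ 0 := by
  classical
  constructor
  · obtain ⟨S, rfl⟩ := hJ
    have e : Ideal.span ((fun s => monomial s (1 : k)) '' S) ⊔ lastVars k d i =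
        Ideal.span ((fun s => monomial s (1 : k)) ''
          (S ∪ (fun j => Finsupp.single j 1) '' {j : Fin d | i ≤ j.val})) := by
      rw [Set.image_union, Ideal.span_union, Set.image_image]
      rfl
    rw [e, mem_ideal_span_monomial_image, mem_ideal_span_monomial_image]
    intro h
    obtain ⟨s, hs, hle⟩ := h β (by simp)
    rcases hs with hs | ⟨j, hj, rfl⟩
    · left
      intro ξ hξ
      have : β = ξ := by simpa [coeff_monomial] using hξ
      exact ⟨s, hs, this ▸ hle⟩
    · right
      refine ⟨j, hj, ?_⟩
      have := hle j
      simp only [Finsupp.single_eq_same] at this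
      omega
  · rintro (h | ⟨j, hj, hβ⟩)
    · exact Ideal.mem_sup_left h
    · refine Ideal.mem_sup_right (monomial_mem_of_le (μ := Finsupp.single j 1) ?_ ?_)
      · rw [Finsupp.single_le_iff]
        omega
      · exact Ideal.subset_span ⟨j, hj, rfl⟩

/-! ### Partial degrees and exchange in strongly stable ideals. -/

lemma partialDegree_add {i : ℕ} (μ ν : Fin d →₀ ℕ) :
    partialDegree i (μ + ν) = partialDegree i μ + partialDegree i ν := by
  simp [partialDegree, Finset.sum_add_distrib]

lemma partialDegree_single {i : ℕ} (a : Fin d) :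
    partialDegree i (Finsupp.single a 1) = if a.val < i then 1 else 0 := by
  classical
  simp [partialDegree, Finsupp.single_apply, Finset.sum_ite_eq]

lemma partialDegree_eq_degree {i : ℕ} {μ : Fin d →₀ ℕ} (h : ∀ j : Fin d, μ j ≠ 0 → j.val < i) :
    partialDegree i μ = μ.degree := by
  rw [Finsupp.degree_eq_sum, partialDegree, Finset.sum_filter]
  refine Finset.sum_congr rfl fun j _ => ?_
  by_cases hj : μ j = 0
  · simp [hj]
  · simp [h j hj]

lemma IsStronglyStable.exchange (hJ : IsStronglyStable J) {a b : Fin d} (hab : a ≤ b)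
    {μ : Fin d →₀ ℕ} (h : monomial (μ + Finsupp.single b 1) (1 : k) ∈ J) :
    monomial (μ + Finsupp.single a 1) (1 : k) ∈ J := by
  rcases hab.eq_or_lt with rfl | hab
  · exact h
  · have e : ∀ c : Fin d, monomial (μ + Finsupp.single c 1) (1 : k) = monomial μ 1 * X c :=
      fun c => by rw [X, monomial_mul, one_mul]
    rw [e] at h ⊢
    exact hJ.2 a b μ hab h

/-- Exchanging inside a monomial: if `x^ν ∈ J` has `x_m`-exponent one more than `x^β` and does not
exceed it elsewhere, and is strictly smaller at some `l ≤ m`, then `x^β ∈ J`. -/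
lemma IsStronglyStable.mem_of_exchange (hJ : IsStronglyStable J) {β ν : Fin d →₀ ℕ} {l m : Fin d}
    (hlm : l ≤ m) (hν : monomial ν (1 : k) ∈ J) (hle : ν ≤ β + Finsupp.single m 1)
    (hl : ν l < (β + Finsupp.single m 1 : Fin d →₀ ℕ) l) : monomial β (1 : k) ∈ J := by
  classical
  by_cases hm : ν m ≤ β m
  · refine monomial_mem_of_le (fun c => ?_) hν
    by_cases hc : c = m
    · exact hc ▸ hm
    · simpa [Finsupp.single_apply, Ne.symm hc] using hle c
  -- Here `ν m = β m + 1`. Trading this one extra `x_m` for `x_l`, where `ν` has room, gives a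
  -- divisor of `x^β`.
  · have hlm' : l ≠ m := by
      rintro rfl
      simp at hl
      omega
    have e : ν - Finsupp.single m 1 + Finsupp.single m 1 = ν :=
      tsub_add_cancel_of_le (by rw [Finsupp.single_le_iff]; omega)
    rw [← e] at hν
    refine monomial_mem_of_le (fun c => ?_) (hJ.exchange hlm hν)
    have hc := hle c
    simp only [Finsupp.add_apply, Finsupp.tsub_apply, Finsupp.single_apply] at hc hl ⊢
    by_cases h1 : m = c
    · subst h1
      simp [hlm'] at hc ⊢
      exact hc
    · by_cases h2 : l = c
      · subst h2
        simp [h1] at hl ⊢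
        omega
      · simp [h1, h2] at hc ⊢
        exact hc

/-- A minimal generator of largest `i`-th partial degree involves only the first `i` variables. -/
lemma IsStronglyStable.lt_of_partialDegree_eq_omega (hJ : IsStronglyStable J) {i : ℕ}
    (hi1 : 1 ≤ i) {μ : Fin d →₀ ℕ} (hμ : IsMinimalGenerator J μ)
    (hw : omega i J ∈ upperBounds (generatorPartialDegrees i J))
    (h : partialDegree i μ = omega i J) (b : Fin d) (hb : μ b ≠ 0) : b.val < i := by
  classical
  by_contra! hbi
  have hbd := b.isLt
  -- With indices from zero, `a` is `x_i`, the last variable that counts for the partial degree.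
  set a : Fin d := ⟨i - 1, by omega⟩ with ha
  have hab : a ≤ b := by
    rw [Fin.le_def, ha]
    simp only
    omega
  obtain ⟨ν, rfl⟩ : ∃ ν, μ = ν + Finsupp.single b 1 :=
    ⟨μ - Finsupp.single b 1, (tsub_add_cancel_of_le (by rw [Finsupp.single_le_iff]; omega)).symm⟩
  have hν : monomial ν (1 : k) ∉ J := fun hν => by
    have := hμ.eq_of_le hν le_self_add
    simp at this
  obtain ⟨w, hwle, hwg⟩ := exists_isMinimalGenerator_le (hJ.exchange hab hμ.1)
  -- Replacing the late `x_b` by `x_a` raises the partial degree to `ω_i(J) + 1`, which no generator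
  -- attains. So `w` falls short at some `c ≤ a`, and exchange forces `x^ν ∈ J`.
  have hlt : partialDegree i w < partialDegree i (ν + Finsupp.single a 1) := by
    have h1 := hw ⟨w, hwg, rfl⟩
    rw [← h] at h1
    rw [partialDegree_add, partialDegree_single] at h1 ⊢
    rw [if_neg (by omega)] at h1
    rw [if_pos (by simp only [ha]; omega)]
    omega
  obtain ⟨c, hc, hclt⟩ := Finset.exists_lt_of_sum_lt hlt
  refine hν (hJ.mem_of_exchange (l := c) (m := a) ?_ hwg.1 hwle hclt)
  have := (Finset.mem_filter.1 hc).2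
  rw [Fin.le_def, ha]
  simp only
  omega

lemma IsStronglyStable.exists_isMinimalGenerator_omega (hJ : IsStronglyStable J) (hJ0 : J ≠ ⊥)
    {i : ℕ} (hi1 : 1 ≤ i) :
    ∃ μ, IsMinimalGenerator J μ ∧ (∀ b : Fin d, μ b ≠ 0 → b.val < i) ∧ μ.degree = omega i J := by
  have hg := isGreatest_omega hJ.1 hJ0 i
  obtain ⟨μ, hμ, hd⟩ := hg.1
  have hs := hJ.lt_of_partialDegree_eq_omega hi1 hμ hg.2 hd
  exact ⟨μ, hμ, hs, by rw [← hd, partialDegree_eq_degree hs]⟩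

/-- A monomial of `J` in the first `i` variables, of degree larger than `ω_i(J)`, stays in `J` when
divided by its last variable. -/
lemma IsStronglyStable.mem_of_add_single_mem (hJ : IsStronglyStable J) {i : ℕ}
    (hw : omega i J ∈ upperBounds (generatorPartialDegrees i J)) {γ : Fin d →₀ ℕ} {m : Fin d}
    (hmi : m.val < i) (hγ : ∀ l, γ l ≠ 0 → l ≤ m) (hdeg : omega i J ≤ γ.degree)
    (h : monomial (γ + Finsupp.single m 1) (1 : k) ∈ J) : monomial γ (1 : k) ∈ J := by
  classical
  obtain ⟨g, hgle, hg⟩ := exists_isMinimalGenerator_le h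
  have hsupp : ∀ l, (γ + Finsupp.single m 1 : Fin d →₀ ℕ) l ≠ 0 → l ≤ m := fun l hl => by
    by_cases hlm : l = m
    · exact hlm.le
    · exact hγ l (by simpa [Finsupp.single_apply, Ne.symm hlm] using hl)
  have hgm : ∀ l, g l ≠ 0 → l ≤ m := fun l hl => hsupp l (by have := hgle l; omega)
  -- `g` only involves variables up to `x_m`, so its full degree is its `i`-th partial degree.
  have hgd : g.degree ≤ omega i J := by
    rw [← partialDegree_eq_degree (i := i) fun l hl => lt_of_le_of_lt (Fin.le_def.1 (hgm l hl)) hmi]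
    exact hw ⟨g, hg, rfl⟩
  have hlt : g.degree < (γ + Finsupp.single m 1).degree := by
    rw [map_add, Finsupp.degree_single]
    omega
  rw [Finsupp.degree_eq_sum, Finsupp.degree_eq_sum] at hlt
  obtain ⟨l, -, hl⟩ := Finset.exists_lt_of_sum_lt hlt
  exact hJ.mem_of_exchange (hsupp l (by omega)) hg.1 hgle hl

/-- In each multidegree `α` the upper Koszul complex of `J + (x_{i+1}, …, x_d)` is a cone in degrees
above `ω_i(J)`. -/
lemma IsStronglyStable.exists_cone_vertex (hJ : IsStronglyStable J) (hJ0 : J ≠ ⊥) {i : ℕ}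
    (hi1 : 1 ≤ i) {α : Fin d →₀ ℕ} (hα : α ≠ 0) :
    ∃ m, α m ≠ 0 ∧ ∀ γ ≤ α, omega i J ≤ γ.degree →
      monomial (γ + Finsupp.single m 1) (1 : k) ∈ J ⊔ lastVars k d i →
      monomial γ (1 : k) ∈ J ⊔ lastVars k d i := by
  classical
  simp only [hJ.1.monomial_mem_sup_lastVars]
  by_cases hs : (Finset.univ.filter fun l : Fin d => l.val < i ∧ α l ≠ 0).Nonempty
  · obtain ⟨m, hm, hmax⟩ := Finset.exists_max_image _ id hs
    simp only [Finset.mem_filter, Finset.mem_univ, true_and, id] at hm hmax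
    refine ⟨m, hm.2, fun γ hγ hdeg h => ?_⟩
    -- If `γ` contains a late variable it is already in the ideal; otherwise `m` bounds its support.
    by_cases hlast : ∃ j : Fin d, i ≤ j.val ∧ γ j ≠ 0
    · exact Or.inr hlast
    · push Not at hlast
      rcases h with h | ⟨j, hj, hj0⟩
      · refine Or.inl (hJ.mem_of_add_single_mem (isGreatest_omega hJ.1 hJ0 i).2 hm.1 ?_ hdeg h)
        intro l hl
        refine hmax l ⟨?_, by have := hγ l; omega⟩
        by_contra! hli
        exact hl (hlast l hli)
      · refine absurd (hlast j hj) ?_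
        have hjm : m ≠ j := by
          rintro rfl
          omega
        simpa [Finsupp.single_apply, hjm] using hj0
  -- Only late variables occur in `α`, so any of them serves: `γ ≠ 0` contains a late variable, and
  -- `γ = 0` forces `ω_i(J) = 0`, whence `1 ∈ J`.
  · obtain ⟨m, hm⟩ := Finsupp.ne_iff.1 hα
    refine ⟨m, hm, fun γ hγ hdeg _ => ?_⟩
    by_cases hγ0 : γ = 0
    · obtain ⟨w, hw, -, hwd⟩ := hJ.exists_isMinimalGenerator_omega hJ0 hi1
      left
      have : w.degree = 0 := by
        rw [hγ0, map_zero] at hdeg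
        omega
      rw [hγ0, ← (Finsupp.degree_eq_zero_iff w).1 this]
      exact hw.1
    · obtain ⟨l, hl⟩ := Finsupp.ne_iff.1 hγ0
      refine Or.inr ⟨l, ?_, hl⟩
      by_contra! hli
      refine hs ⟨l, ?_⟩
      have := hγ l
      simp only [Finsupp.coe_zero, Pi.zero_apply] at hl
      simp only [Finset.mem_filter, Finset.mem_univ, true_and]
      exact ⟨hli, by omega⟩

end Monomials

/-! ### Multidegrees in the Koszul complex -/

section Koszul

variable {k : Type*} [Field k] {d : ℕ}

/-- The multidegree `∑_{j ∈ F} e_j` of the Koszul basis element `e_F`. -/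
def indicatorExponent (F : Finset (Fin d)) : Fin d →₀ ℕ := ∑ j ∈ F, Finsupp.single j 1

lemma indicatorExponent_insert {j : Fin d} {F : Finset (Fin d)} (hj : j ∉ F) :
    indicatorExponent (insert j F) = Finsupp.single j 1 + indicatorExponent F :=
  Finset.sum_insert hj

lemma indicatorExponent_apply_of_notMem {j : Fin d} {F : Finset (Fin d)} (hj : j ∉ F) :
    indicatorExponent F j = 0 := by
  classical
  simp [indicatorExponent, Finsupp.finsetSum_apply, Finsupp.single_apply, hj]

lemma koszulD_apply (M : Type*) [AddCommGroup M] [Module (MvPolynomial (Fin d) k) M]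
    (f : Finset (Fin d) → M) (G : Finset (Fin d)) :
    koszulD k d M f G =
      ∑ j ∈ Gᶜ, koszulSign j G • ((X j : MvPolynomial (Fin d) k) • f (insert j G)) := rfl

lemma koszulH_zero (m : Fin d) :
    koszulH m (0 : Finset (Fin d) → MvPolynomial (Fin d) k) = 0 := by
  funext G
  simp [koszulH]

open scoped Classical in
/-- The part of a Koszul chain supported in the multidegrees satisfying `P`. -/
def multidegreePart (P : (Fin d →₀ ℕ) → Prop) (f : Finset (Fin d) → MvPolynomial (Fin d) k) :
    Finset (Fin d) → MvPolynomial (Fin d) k :=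
  fun F => ∑ β ∈ (f F).support with P (β + indicatorExponent F), monomial β (coeff β (f F))

open scoped Classical in
lemma coeff_multidegreePart (P : (Fin d →₀ ℕ) → Prop)
    (f : Finset (Fin d) → MvPolynomial (Fin d) k) (F : Finset (Fin d)) (β : Fin d →₀ ℕ) :
    coeff β (multidegreePart P f F) =
      if P (β + indicatorExponent F) then coeff β (f F) else 0 := by
  simp only [multidegreePart, coeff_sum, coeff_monomial, Finset.sum_ite_eq', Finset.mem_filter,
    mem_support_iff]
  by_cases h : coeff β (f F) = 0 <;> simp [h]

lemma multidegreePart_zero (P : (Fin d →₀ ℕ) → Prop) :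
    multidegreePart P (0 : Finset (Fin d) → MvPolynomial (Fin d) k) = 0 := by
  funext F
  simp [multidegreePart]

/-- The differential preserves multidegree: it moves a variable from the exterior factor to the
coefficient. -/
lemma koszulD_multidegreePart (P : (Fin d →₀ ℕ) → Prop)
    (f : Finset (Fin d) → MvPolynomial (Fin d) k) :
    koszulD k d _ (multidegreePart P f) = multidegreePart P (koszulD k d _ f) := by
  classical
  funext G
  ext β
  rw [coeff_multidegreePart, koszulD_apply, koszulD_apply, coeff_sum, coeff_sum]
  have key : ∀ j ∈ Gᶜ, coeff β (koszulSign j G • ((X j : MvPolynomial (Fin d) k) •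
      multidegreePart P f (insert j G))) = if P (β + indicatorExponent G) then
        coeff β (koszulSign j G • ((X j : MvPolynomial (Fin d) k) • f (insert j G))) else 0 := by
    intro j hj
    rw [coeff_smul, coeff_smul, smul_eq_mul, smul_eq_mul, coeff_X_mul', coeff_X_mul',
      coeff_multidegreePart, indicatorExponent_insert (by simpa using hj), ← add_assoc]
    by_cases hβ : j ∈ β.support
    · rw [tsub_add_cancel_of_le]
      · split_ifs <;> simp
      · rw [Finsupp.single_le_iff]
        exact Nat.one_le_iff_ne_zero.2 (Finsupp.mem_support_iff.1 hβ)
    · simp [hβ]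
  rw [Finset.sum_congr rfl key]
  split_ifs <;> simp

/-- On cycles whose multidegrees involve `x_m`, the homotopy `koszulH m` inverts `koszulD`. -/
lemma koszulD_koszulH_multidegreePart {m : Fin d} {P : (Fin d →₀ ℕ) → Prop}
    (hP : ∀ α, P α → α m ≠ 0) {f : Finset (Fin d) → MvPolynomial (Fin d) k}
    (hf : koszulD k d _ f = 0) :
    koszulD k d _ (koszulH m (multidegreePart P f)) = multidegreePart P f := by
  classical
  funext F
  have h := koszul_homotopy m (multidegreePart P f) F
  rw [koszulD_multidegreePart, hf, multidegreePart_zero, koszulH_zero, Pi.zero_apply,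
    add_zero] at h
  rw [h, sub_eq_self]
  split_ifs with hm
  · rfl
  -- The error term of the homotopy consists of terms where `x_m` occurs neither in `x^β` nor in
  -- `e_F`; `P` excludes them.
  · ext β
    rw [coeff_zero]
    by_cases hβ : Finsupp.single m 1 ≤ β
    · exact coeff_modMonomial_of_le _ hβ
    · rw [coeff_modMonomial_of_not_le _ hβ, coeff_multidegreePart, if_neg]
      intro hPβ
      refine hP _ hPβ ?_
      rw [Finsupp.single_le_iff] at hβ
      rw [Finsupp.add_apply, indicatorExponent_apply_of_notMem hm]
      omega

lemma coeff_koszulH_ne_zero {m : Fin d} {f : Finset (Fin d) → MvPolynomial (Fin d) k}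
    {G : Finset (Fin d)} {γ : Fin d →₀ ℕ} (h : coeff γ (koszulH m f G) ≠ 0) :
    m ∈ G ∧ coeff (γ + Finsupp.single m 1) (f (G.erase m)) ≠ 0 := by
  unfold koszulH at h
  split_ifs at h with hm
  · refine ⟨hm, fun h0 => h ?_⟩
    rw [coeff_smul, coeff_divMonomial, add_comm, h0, smul_zero]
  · exact absurd (coeff_zero γ) h

/-- A cycle is a boundary if each multidegree `α` has a variable `x_{v α}` occurring in it; the
bounding chain has only coefficients at `γ` in `e_G` with `γ + e_m` occurring in the coefficient of
`e_{G \ {m}}` of the cycle, where `m = v α`. -/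
theorem exists_koszulD_eq (v : (Fin d →₀ ℕ) → Fin d)
    (f : Finset (Fin d) → MvPolynomial (Fin d) k) (hf : koszulD k d _ f = 0)
    (hv : ∀ F β, coeff β (f F) ≠ 0 →
      (β + indicatorExponent F) (v (β + indicatorExponent F)) ≠ 0) :
    ∃ g : Finset (Fin d) → MvPolynomial (Fin d) k, koszulD k d _ g = f ∧
      ∀ G γ, coeff γ (g G) ≠ 0 → v (γ + indicatorExponent G) ∈ G ∧
        coeff (γ + Finsupp.single (v (γ + indicatorExponent G)) 1)
          (f (G.erase (v (γ + indicatorExponent G)))) ≠ 0 := by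
  classical
  -- The multidegrees are sorted by their chosen variable, and each part of `f` is contracted in its
  -- own direction.
  set P : Fin d → (Fin d →₀ ℕ) → Prop := fun m α => α m ≠ 0 ∧ v α = m with hP
  refine ⟨∑ m, koszulH m (multidegreePart (P m) f), ?_, ?_⟩
  · rw [map_sum, Finset.sum_congr rfl fun m _ =>
      koszulD_koszulH_multidegreePart (fun α (h : P m α) => h.1) hf]
    funext F
    ext β
    rw [Finset.sum_apply, coeff_sum]
    simp only [coeff_multidegreePart, hP]
    by_cases h : coeff β (f F) = 0
    · simp [h]
    · rw [Finset.sum_eq_single (v (β + indicatorExponent F))]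
      · rw [if_pos ⟨hv F β h, rfl⟩]
      · intro m _ hm
        rw [if_neg fun h' => hm h'.2.symm]
      · simp
  · intro G γ h
    rw [Finset.sum_apply, coeff_sum] at h
    obtain ⟨m, -, hm⟩ := Finset.exists_ne_zero_of_sum_ne_zero h
    obtain ⟨hmG, hc⟩ := coeff_koszulH_ne_zero hm
    rw [coeff_multidegreePart] at hc
    split_ifs at hc with hPm
    · have e : γ + Finsupp.single m 1 + indicatorExponent (G.erase m) =
          γ + indicatorExponent G := by
        rw [add_assoc, ← indicatorExponent_insert (Finset.notMem_erase m G),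
          Finset.insert_erase hmG]
      rw [e] at hPm
      rw [hPm.2]
      exact ⟨hmG, hc⟩
    · exact absurd rfl hc

end Koszul

/-! ### Graded `Tor` of ideals -/

section Tor

variable {k : Type*} [Field k] {d : ℕ} {I : Ideal (MvPolynomial (Fin d) k)}

lemma mem_idealGrading {j : ℤ} {q : I} :
    q ∈ idealGrading I j ↔
      ∀ β, coeff β (q : MvPolynomial (Fin d) k) ≠ 0 → (β.degree : ℤ) = j := by
  have e : ∀ β : Fin d →₀ ℕ, Finsupp.weight (fun _ : Fin d => (1 : ℤ)) β = (β.degree : ℤ) := by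
    intro β
    rw [Finsupp.weight_eq_sum, Finsupp.degree_eq_sum]
    simp
  simp only [← e]
  rfl

lemma mem_koszulPiece {p : ℕ} {j : ℤ} {f : Finset (Fin d) → I} :
    f ∈ koszulPiece (idealGrading I) p j ↔
      ∀ F β, coeff β (f F : MvPolynomial (Fin d) k) ≠ 0 →
        F.card = p ∧ (β.degree : ℤ) = j - p := by
  rw [koszulPiece, Submodule.mem_pi]
  refine forall_congr' fun F => ?_
  by_cases hF : F.card = p
  · simp [hF, mem_idealGrading]
  · simp only [Set.mem_univ, hF, if_false, true_imp_iff, false_and, Submodule.mem_bot, imp_false,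
      not_not]
    rw [← Subtype.coe_inj, MvPolynomial.ext_iff]
    rfl

lemma coe_koszulD (f : Finset (Fin d) → I) (G : Finset (Fin d)) :
    (koszulD k d I f G : MvPolynomial (Fin d) k) =
      koszulD k d _ (fun F => (f F : MvPolynomial (Fin d) k)) G := by
  simp [koszulD_apply]

lemma koszulD_coe_eq_zero {f : Finset (Fin d) → I} (hf : koszulD k d I f = 0) :
    koszulD k d _ (fun F => (f F : MvPolynomial (Fin d) k)) = 0 := by
  funext G
  rw [← coe_koszulD, hf]
  rfl

lemma nontrivial_gradedTor_iff {p : ℕ} {j : ℤ} :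
    Nontrivial (GradedTor (d := d) (idealGrading I) p j) ↔
      ¬ koszulCycles (d := d) (idealGrading I) p j ≤ koszulBoundaries (idealGrading I) p j :=
  Submodule.Quotient.nontrivial_iff.trans (not_congr Submodule.submoduleOf_eq_top)

/-- Graded `Tor` of a monomial ideal vanishes where the upper Koszul complexes are cones. -/
theorem IsMonomialIdeal.koszulCycles_le_koszulBoundaries (hI : IsMonomialIdeal I) {N : ℕ}
    (hcone : ∀ α : Fin d →₀ ℕ, α ≠ 0 → ∃ m, α m ≠ 0 ∧ ∀ γ ≤ α, N ≤ γ.degree →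
      monomial (γ + Finsupp.single m 1) (1 : k) ∈ I → monomial γ (1 : k) ∈ I)
    {p : ℕ} {j : ℤ} (hN : (N : ℤ) < j - p) :
    koszulCycles (d := d) (idealGrading I) p j ≤ koszulBoundaries (idealGrading I) p j := by
  classical
  rintro f ⟨hfp, hfc⟩
  have hfp := mem_koszulPiece.1 hfp
  have hfD : koszulD k d I f = 0 := hfc
  have hne : ∀ F β, coeff β (f F : MvPolynomial (Fin d) k) ≠ 0 → β ≠ 0 := by
    rintro F β h rfl
    have := (hfp F 0 h).2
    rw [map_zero] at this
    push_cast at this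
    omega
  -- Without variables there is no value for `v` at `α = 0`, so `d = 0` is separate.
  by_cases hd : IsEmpty (Fin d)
  · have : f = 0 := by
      funext F
      rw [← Subtype.coe_inj, MvPolynomial.ext_iff]
      intro β
      by_contra h
      exact hne F β h (Subsingleton.elim _ _)
    rw [this]
    exact Submodule.zero_mem _
  rw [not_isEmpty_iff] at hd
  have hex : ∀ α : Fin d →₀ ℕ, ∃ m, α ≠ 0 → α m ≠ 0 ∧ ∀ γ ≤ α, N ≤ γ.degree →
      monomial (γ + Finsupp.single m 1) (1 : k) ∈ I → monomial γ (1 : k) ∈ I := fun α => by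
    by_cases h : α = 0
    · exact ⟨Classical.arbitrary _, fun h' => absurd h h'⟩
    · obtain ⟨m, hm⟩ := hcone α h
      exact ⟨m, fun _ => hm⟩
  choose v hv using hex
  obtain ⟨g, hgD, hg⟩ := exists_koszulD_eq v (fun F => (f F : MvPolynomial (Fin d) k))
    (koszulD_coe_eq_zero hfD) fun F β h => (hv _ fun h0 => hne F β h (add_eq_zero.1 h0).1).1
  have hgdeg : ∀ G γ, coeff γ (g G) ≠ 0 → G.card = p + 1 ∧ (γ.degree : ℤ) = j - (p + 1 : ℕ) := by
    intro G γ h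
    obtain ⟨hmem, hc⟩ := hg G γ h
    obtain ⟨h1, h2⟩ := hfp _ _ hc
    rw [Finset.card_erase_of_mem hmem] at h1
    rw [map_add, Finsupp.degree_single] at h2
    have := Finset.card_pos.2 ⟨_, hmem⟩
    push_cast at h2 ⊢
    exact ⟨by omega, by omega⟩
  have hgI : ∀ G, g G ∈ I := by
    intro G
    rw [hI.mem_iff]
    intro γ h
    obtain ⟨hmem, hc⟩ := hg G γ h
    refine (hv (γ + indicatorExponent G) ?_).2 γ le_self_add ?_
      ((hI.mem_iff _).1 (f (G.erase (v (γ + indicatorExponent G)))).2 _ hc)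
    · intro h0
      have h1 := (add_eq_zero.1 h0).2
      obtain ⟨c, hc⟩ : ∃ c, c ∈ G := ⟨_, hmem⟩
      rw [← Finset.insert_erase hc, indicatorExponent_insert (Finset.notMem_erase _ _)] at h1
      simpa using (add_eq_zero.1 h1).1
    -- The homotopy lowers the coefficient degree to `j - p - 1`, which is still at least `N`
    -- because `N < j - p` is strict.
    · have := (hgdeg G γ h).2
      push_cast at this
      omega
  refine ⟨fun G => ⟨g G, hgI G⟩, mem_koszulPiece.2 hgdeg, ?_⟩
  funext G
  refine Subtype.ext ?_
  change (koszulD k d I (fun G => (⟨g G, hgI G⟩ : I)) G : MvPolynomial (Fin d) k) = f G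
  rw [coe_koszulD, hgD]

/-- A minimal monomial generator of degree `n` gives a nonzero class in `Tor_0(I, k)_n`. -/
theorem IsMinimalGenerator.degree_mem_torShifts (hI : IsMonomialIdeal I) {w : Fin d →₀ ℕ}
    (hw : IsMinimalGenerator I w) : (w.degree : ℤ) ∈ torShifts d (idealGrading I) := by
  classical
  refine ⟨0, w.degree, ?_, by simp⟩
  rw [nontrivial_gradedTor_iff]
  intro hle
  set f : Finset (Fin d) → I := fun F => if F = ∅ then ⟨monomial w 1, hw.1⟩ else 0 with hf
  have hfc : f ∈ koszulCycles (d := d) (idealGrading I) 0 (w.degree : ℤ) := by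
    refine ⟨mem_koszulPiece.2 fun F β h => ?_, ?_⟩
    · by_cases hF : F = ∅
      · simp only [hf, hF, if_true, coeff_monomial] at h
        have hβ : w = β := by
          by_contra h'
          simp [h'] at h
        simp [hF, hβ]
      · simp [hf, hF] at h
    · change koszulD k d I f = 0
      funext G
      rw [koszulD_apply]
      exact Finset.sum_eq_zero fun j _ => by simp [hf]
  obtain ⟨g, -, hg⟩ := hle hfc
  have h1 : koszulD k d I g ∅ = f ∅ := congrFun hg ∅
  have h2 : coeff w (koszulD k d I g ∅ : MvPolynomial (Fin d) k) = 1 := by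
    rw [h1]
    simp [hf]
  rw [coe_koszulD, koszulD_apply, coeff_sum] at h2
  -- Were `x^w` a boundary, some `x^w / x_j` would occur in an element of `I`, against minimality of
  -- `w`.
  obtain ⟨j, -, hj⟩ := Finset.exists_ne_zero_of_sum_ne_zero (by rw [h2]; exact one_ne_zero)
  rw [coeff_smul, smul_eq_mul, coeff_X_mul'] at hj
  split_ifs at hj with hjw
  · have hmem := (hI.mem_iff _).1 (g (insert j ∅)).2 (w - Finsupp.single j 1)
      fun h => hj (by rw [h, smul_zero])
    have := DFunLike.congr_fun (hw.eq_of_le hmem tsub_le_self) j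
    have h0 := Finsupp.mem_support_iff.1 hjw
    simp at this
    omega
  · exact hj (smul_zero _)

end Tor

/-! ### The regularity after adding the last variables. -/

lemma IsMinimalGenerator.sup_lastVars {k : Type*} [Field k] {d : ℕ}
    {J : Ideal (MvPolynomial (Fin d) k)} (hJ : IsMonomialIdeal J) {i : ℕ} {w : Fin d →₀ ℕ}
    (hw : IsMinimalGenerator J w) (hs : ∀ b : Fin d, w b ≠ 0 → b.val < i) :
    IsMinimalGenerator (J ⊔ lastVars k d i) w := by
  refine ⟨Ideal.mem_sup_left hw.1, fun ν hν hle => ?_⟩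
  rcases hJ.monomial_mem_sup_lastVars.1 hν with h | ⟨j, hj, hj0⟩
  · exact hw.2 h hle
  · have := hs j (by have := hle j; omega)
    omega

lemma IsStronglyStable.isGreatest_torShifts {k : Type*} [Field k] {d : ℕ}
    {J : Ideal (MvPolynomial (Fin d) k)} (hJ : IsStronglyStable J) (hJ0 : J ≠ ⊥) {i : ℕ}
    (hi1 : 1 ≤ i) :
    IsGreatest (torShifts d (idealGrading (J ⊔ lastVars k d i))) (omega i J : ℤ) := by
  have hI := hJ.1.sup_lastVars i
  constructor
  · obtain ⟨w, hw, hs, hdeg⟩ := hJ.exists_isMinimalGenerator_omega hJ0 hi1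
    rw [← hdeg]
    exact (hw.sup_lastVars hJ.1 hs).degree_mem_torShifts hI
  · rintro r ⟨p, j, hnt, rfl⟩
    by_contra! hlt
    exact nontrivial_gradedTor_iff.1 hnt
      (hI.koszulCycles_le_koszulBoundaries (fun α hα => hJ.exists_cone_vertex hJ0 hi1 hα) hlt)

end StableReg

end
theorem mainTheorem6 {k : Type*} [Field k] (d : ℕ) (J : Ideal (MvPolynomial (Fin d) k))
    (hJ : StableReg.IsStronglyStable J) (hJ0 : J ≠ ⊥) (i : ℕ) (hi1 : 1 ≤ i) (hid : i ≤ d) :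
    IsGreatest (StableReg.generatorPartialDegrees i J) (StableReg.omega i J) ∧
    IsGreatest (StableReg.torShifts d (StableReg.idealGrading (J ⊔ StableReg.lastVars k d i)))
      (StableReg.reg (J ⊔ StableReg.lastVars k d i)) ∧
    StableReg.reg (J ⊔ StableReg.lastVars k d i) = (StableReg.omega i J : ℤ) := by
  have h := hJ.isGreatest_torShifts hJ0 hi1
  have e : StableReg.reg (J ⊔ StableReg.lastVars k d i) = (StableReg.omega i J : ℤ) := h.csSup_eq
  exact ⟨StableReg.isGreatest_omega hJ.1 hJ0 i, e ▸ h, e⟩
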